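/- Let $(N_j)_{j\ge1},(M_j)_{j\ge1},(K_j)_{j\ge1}$ be sequences of positive integers and $(\alpha_j)_{j\ge1}$ a sequence of integers such that, for all $j$, $$N_j\ge 2,\qquad N_j=M_jK_j+\alpha_j,\qquad 0\le\alpha_j<M_j,\qquad\text{and}\qquad \sum_{j=1}^\infty\frac{\alpha_j\sqrt{M_j}}{K_j}<\infty .$$ Put $B_j=\{0,K_j,\dots,(M_j-1)K_j\}$ and $\nu_j=\frac1{M_j}\sum_{b\in B_j}\delta_{b/(N_1\cdots N_j)}$. Call $(N_j,B_j)_{j\ge 1}$ the tower given by these data. Let $$K_\mu=\Big\{\sum_{j=1}^\infty\frac{b_j}{N_1\cdots N_j}\;:\; b_j\in B_j\text{ for all }j\Big\}.$$ (1) The infinite convolution $\mu=\nu_1*\nu_2*\cdots$ exists (as the weak limit of the measures $\nu_1*\cdots*\nu_n$), its support is $K_\mu$, and $$\dim_H(K_\mu)=\liminf_{j\to\infty}\frac{\log(M_1\cdots M_j)}{\log(N_1\cdots N_j)} .$$ (2) If $p$ is an odd prime, then $N_j=p^j$, $M_j=2$, $\alpha_j=1$, $K_j=(p^j-1)/2$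 satisfy the conditions above, and $\dim_H(K_\mu)=0$. (3) If $p$ is a prime with $p\equiv 3\pmod 4$, then $N_j=p^{2j-1}$, $M_j=2$, $\alpha_j=1$, $K_j=(p^{2j-1}-1)/2$ (the data of the example of a non-spectral measure with a Fourier frame) satisfy the conditions above, and $\dim_H(K_\mu)=0$. (4) Let $0<\beta<2$ and $a\ge1$ be real numbers with $a(1-\beta/2)>1$, and let $K_j\ge2$ and $M_j$ be integers with $K_j\ge j^a$ and $M_j=K_j^\beta$ for all $j$. Then, with $\alpha_j=1$ and $N_j=M_jK_j+1$, the conditions above are satisfied, and $\dim_H(K_\mu)>0$. Moreover, for every constant $C>0$ such that $C^{-1}\log x\le\log(1+x)\le C\log x$ for all sufficiently large $x$, $$\frac{\beta}{C(1+\beta)}\le\dim_H(K_\mu)\le\frac{C\beta}{1+\beta}.$$ -/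

import Mathlib

open MeasureTheory Filter Topology

noncomputable section

/-- The data `N_j = M_j K_j + α_j`, `0 ≤ α_j < M_j`, `∑ α_j √M_j / K_j < ∞` of the towers
considered here. All sequences are indexed from `0`, so `N j` stands for `N_{j+1}`. -/
structure IsTowerData (N M K α : ℕ → ℕ) : Prop where
  two_le_N : ∀ j, 2 ≤ N j
  M_pos : ∀ j, 0 < M j
  K_pos : ∀ j, 0 < K j
  N_eq : ∀ j, N j = M j * K j + α j
  α_lt : ∀ j, α j < M j
  summable : Summable fun j => (α j : ℝ) * √(M j : ℝ) / (K j : ℝ)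

/-- The digit sets `B_j = {0, K_j, 2 K_j, …, (M_j - 1) K_j}`. -/
def towerDigits (M K : ℕ → ℕ) (j : ℕ) : Finset ℕ :=
  (Finset.range (M j)).image fun i => i * K j

/-- The real number `b / (N_1 ⋯ N_j)` (where the index `j` of the code is `j - 1`). -/
def scaledDigit (N : ℕ → ℕ) (j b : ℕ) : ℝ :=
  (b : ℝ) / ∏ i ∈ Finset.range (j + 1), (N i : ℝ)

/-- The measure `ν_j = (1 / #B_j) ∑_{b ∈ B_j} δ_{b / (N_1 ⋯ N_j)}`. -/
def levelMeasure (N : ℕ → ℕ) (B : ℕ → Finset ℕ) (j : ℕ) : Measure ℝ :=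
  ((B j).card : ENNReal)⁻¹ • ∑ b ∈ B j, Measure.dirac (scaledDigit N j b)

/-- The finite convolution of the first `n` measures of a sequence (`δ_0` for `n = 0`). -/
def partialConv (ν : ℕ → Measure ℝ) : ℕ → Measure ℝ
  | 0 => Measure.dirac 0
  | n + 1 => (partialConv ν n).conv (ν n)

/-- `μ` is the infinite convolution `ν_1 ∗ ν_2 ∗ ⋯`: it is a probability measure, and the finite
convolutions converge weakly to it. There is at most one such `μ`. -/
def IsInfiniteConv (ν : ℕ → Measure ℝ) (μ : Measure ℝ) : Prop :=
  IsProbabilityMeasure μ ∧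
    ∀ f : BoundedContinuousFunction ℝ ℝ,
      Tendsto (fun n => ∫ x, f x ∂(partialConv ν n)) atTop (𝓝 (∫ x, f x ∂μ))

/-- The set `K_μ` of all sums `∑_j b_j / (N_1 ⋯ N_j)` with `b_j ∈ B_j` for all `j`. -/
def moranSet (N : ℕ → ℕ) (B : ℕ → Finset ℕ) : Set ℝ :=
  {x | ∃ b : ℕ → ℕ, (∀ j, b j ∈ B j) ∧ HasSum (fun j => scaledDigit N j (b j)) x}

end

/-! Write P_n = `denom N n` and Q_n = `denom M n`. Each point of the Moran set comes from a digit
sequence ω, and the tail after n digits lies in [0, 1/P_n]. Choosing the digits independently and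
uniformly makes the partial sums have the finite convolutions as laws. Since these sums converge
everywhere, μ is the law of `point`. Its support is the whole compact image because every cylinder
has positive mass.

Dimension, upper bound: Q_n cylinders of diameter at most 1/P_n cover the set, so Q_n ≤ P_n^d for
infinitely many n gives dimension at most d (`dimH_moranSet_le`). Lower bound: if P_n^d ≤ Q_n for
all large n, then μ of an interval of length ρ is at most 15 ρ^d for small ρ
(`law_point_mem_Icc_le_rpow`), and the mass distribution principle applies. At scales between
1/P_{m+1} and 1/P_m this relies on the digits being equally spaced with N_m ≤ 2 M_m K_m: they fill a
fixed proportion of [0, N_m), so no clustering lowers the dimension.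

The examples compute the limit of log Q_n / log P_n: it is 0 when log P_n grows quadratically and
Q_n = 2^n, and β/(1+β) when M_j = K_j^β. -/

noncomputable section

/-! ### Coding of the Moran set by digit sequences. -/

namespace Tower

/-- The product `N_0 ⋯ N_{n-1}`. -/
def denom (N : ℕ → ℕ) (n : ℕ) : ℝ := ∏ i ∈ Finset.range n, (N i : ℝ)

/-- The `j`-th term of the series defined by a sequence of digits. -/
def digitTerm (N M K : ℕ → ℕ) (j : ℕ) (i : Fin (M j)) : ℝ := scaledDigit N j (i * K j)

/-- The sum of the first `n` terms of the series defined by a sequence of digits. -/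
def partialSum (N M K : ℕ → ℕ) (n : ℕ) (ω : ∀ j, Fin (M j)) : ℝ :=
  ∑ j ∈ Finset.range n, digitTerm N M K j (ω j)

/-- The point of the Moran set with a given sequence of digits. -/
def point (N M K : ℕ → ℕ) (ω : ∀ j, Fin (M j)) : ℝ := ∑' j, digitTerm N M K j (ω j)

/-- The integer `N_0 ⋯ N_{n-1}` times the `n`-th partial sum. -/
def code (N M K : ℕ → ℕ) : ℕ → (∀ j, Fin (M j)) → ℕ
  | 0, _ => 0
  | n + 1, ω => N n * code N M K n ω + ω n * K n

variable {N M K α : ℕ → ℕ}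

@[simp] lemma denom_zero : denom N 0 = 1 := by simp [denom]

lemma denom_succ (n : ℕ) : denom N (n + 1) = denom N n * N n := by
  simp [denom, Finset.prod_range_succ]

lemma digitTerm_eq (j : ℕ) (i : Fin (M j)) :
    digitTerm N M K j i = (i : ℝ) * K j / denom N (j + 1) := by
  simp [digitTerm, scaledDigit, denom]

lemma partialSum_succ (n : ℕ) (ω : ∀ j, Fin (M j)) :
    partialSum N M K (n + 1) ω = partialSum N M K n ω + digitTerm N M K n (ω n) := by
  simp [partialSum, Finset.sum_range_succ]

lemma digitTerm_nonneg (j : ℕ) (i : Fin (M j)) : 0 ≤ digitTerm N M K j i := by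
  rw [digitTerm_eq]
  have : 0 ≤ denom N (j + 1) := Finset.prod_nonneg fun _ _ => Nat.cast_nonneg _
  positivity

end Tower

namespace IsTowerData

open Tower

variable {N M K α : ℕ → ℕ} (h : IsTowerData N M K α)

include h

lemma two_pow_le_denom (n : ℕ) : (2 : ℝ) ^ n ≤ denom N n := by
  induction n with
  | zero => simp
  | succ n ih =>
    rw [denom_succ, pow_succ]
    have h1 : (2 : ℝ) ≤ N n := by exact_mod_cast h.two_le_N n
    have h2 : 0 ≤ denom N n := le_trans (by positivity) ih
    gcongr

lemma denom_pos (n : ℕ) : 0 < denom N n := lt_of_lt_of_le (by positivity) (h.two_pow_le_denom n)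

lemma digit_mul_lt (j : ℕ) (i : Fin (M j)) : (i : ℕ) * K j + 1 ≤ N j := by
  have h1 := h.N_eq j
  have h2 : ((i : ℕ) + 1) * K j ≤ M j * K j := Nat.mul_le_mul_right _ i.2
  have h3 := h.K_pos j
  nlinarith

/-- The largest digit is at most N_j - 1. This one-step bound telescopes: partial sum plus 1/P_n is
nonincreasing in n, which controls every tail in `point_le`. -/
lemma digitTerm_le (j : ℕ) (i : Fin (M j)) :
    digitTerm N M K j i + (denom N (j + 1))⁻¹ ≤ (denom N j)⁻¹ := by
  have h0 := h.denom_pos j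
  have h1 : (0 : ℝ) < N j := by exact_mod_cast zero_lt_two.trans_le (h.two_le_N j)
  have h2 : ((i : ℕ) : ℝ) * K j + 1 ≤ N j := by exact_mod_cast h.digit_mul_lt j i
  rw [digitTerm_eq, denom_succ, inv_eq_one_div, inv_eq_one_div, ← add_div,
    div_le_div_iff₀ (by positivity) h0]
  nlinarith

lemma digitTerm_le_pow (j : ℕ) (i : Fin (M j)) : digitTerm N M K j i ≤ (1 / 2) ^ j := by
  have h1 := h.digitTerm_le j i
  have h2 : 0 < (denom N (j + 1))⁻¹ := inv_pos.2 (h.denom_pos _)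
  have h3 : (denom N j)⁻¹ ≤ (2 ^ j)⁻¹ := by
    have := h.two_pow_le_denom j
    gcongr
  rw [one_div, inv_pow]
  linarith

lemma norm_digitTerm_le (j : ℕ) (i : Fin (M j)) : ‖digitTerm N M K j i‖ ≤ (1 / 2) ^ j := by
  rw [Real.norm_of_nonneg (digitTerm_nonneg j i)]
  exact h.digitTerm_le_pow j i

lemma hasSum_point (ω : ∀ j, Fin (M j)) :
    HasSum (fun j => digitTerm N M K j (ω j)) (point N M K ω) :=
  (Summable.of_norm_bounded summable_geometric_two fun j => h.norm_digitTerm_le j (ω j)).hasSum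

lemma tendsto_partialSum (ω : ∀ j, Fin (M j)) :
    Tendsto (fun n => partialSum N M K n ω) atTop (𝓝 (point N M K ω)) :=
  (h.hasSum_point ω).tendsto_sum_nat

lemma partialSum_le_point (n : ℕ) (ω : ∀ j, Fin (M j)) :
    partialSum N M K n ω ≤ point N M K ω :=
  (h.hasSum_point ω).summable.sum_le_tsum _ fun j _ => digitTerm_nonneg j (ω j)

lemma point_le (n : ℕ) (ω : ∀ j, Fin (M j)) :
    point N M K ω ≤ partialSum N M K n ω + (denom N n)⁻¹ := by
  have anti : Antitone fun n => partialSum N M K n ω + (denom N n)⁻¹ := by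
    refine antitone_nat_of_succ_le fun n => ?_
    rw [partialSum_succ]
    linarith [h.digitTerm_le n (ω n)]
  refine le_of_tendsto (h.tendsto_partialSum ω) ?_
  filter_upwards [eventually_ge_atTop n] with m hm
  have h1 := anti hm
  have h2 : 0 < (denom N m)⁻¹ := inv_pos.2 (h.denom_pos _)
  simp only at h1
  linarith

lemma partialSum_eq_code (n : ℕ) (ω : ∀ j, Fin (M j)) :
    partialSum N M K n ω = code N M K n ω / denom N n := by
  induction n with
  | zero => simp [partialSum, code]
  | succ n ih =>
    have h0 := h.denom_pos n
    have h1 : (0 : ℝ) < N n := by exact_mod_cast zero_lt_two.trans_le (h.two_le_N n)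
    rw [partialSum_succ, ih, digitTerm_eq, denom_succ, code]
    push_cast
    field_simp

/-- Digits are smaller than N_n, so `code` is a mixed-radix expansion and Euclidean division by N_n
splits off the last digit. -/
lemma code_succ_div (n : ℕ) (ω : ∀ j, Fin (M j)) :
    code N M K (n + 1) ω / N n = code N M K n ω := by
  have h1 := h.digit_mul_lt n (ω n)
  rw [code, Nat.mul_add_div (by omega), Nat.div_eq_of_lt (by omega), add_zero]

lemma code_succ_mod (n : ℕ) (ω : ∀ j, Fin (M j)) :
    code N M K (n + 1) ω % N n = ω n * K n := by
  have h1 := h.digit_mul_lt n (ω n)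
  rw [code, Nat.mul_add_mod, Nat.mod_eq_of_lt (by omega)]

/-- The integer `code n ω` determines the first `n` digits of `ω`. -/
lemma eq_of_code_eq {n : ℕ} {ω ω' : ∀ j, Fin (M j)} (hc : code N M K n ω = code N M K n ω') :
    ∀ j < n, ω j = ω' j := by
  induction n with
  | zero => simp
  | succ n ih =>
    intro j hj
    rcases Nat.lt_succ_iff_lt_or_eq.1 hj with hj | rfl
    · refine ih ?_ j hj
      rw [← h.code_succ_div n ω, hc, h.code_succ_div]
    · have := h.code_succ_mod j ω
      rw [hc, h.code_succ_mod] at this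
      exact Fin.ext (Nat.eq_of_mul_eq_mul_right (h.K_pos j) this.symm)

lemma continuous_point : Continuous (point N M K) :=
  continuous_tsum (fun j => (continuous_of_discreteTopology (f := digitTerm N M K j)).comp
      (continuous_apply j))
    summable_geometric_two fun j ω => h.norm_digitTerm_le j (ω j)

lemma card_towerDigits (j : ℕ) : (towerDigits M K j).card = M j := by
  rw [towerDigits, Finset.card_image_of_injective, Finset.card_range]
  exact fun a b hab => Nat.eq_of_mul_eq_mul_right (h.K_pos j) hab

lemma moranSet_eq_range : moranSet N (towerDigits M K) = Set.range (point N M K) := by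
  ext x
  constructor
  · rintro ⟨b, hb, hx⟩
    simp only [towerDigits, Finset.mem_image, Finset.mem_range] at hb
    choose i hi hb using hb
    refine ⟨fun j => ⟨i j, hi j⟩, (h.hasSum_point _).unique ?_⟩
    simpa [digitTerm, hb] using hx
  · rintro ⟨ω, rfl⟩
    exact ⟨fun j => ω j * K j, fun j => Finset.mem_image_of_mem _ (Finset.mem_range.2 (ω j).2),
      h.hasSum_point ω⟩

lemma isCompact_moranSet : IsCompact (moranSet N (towerDigits M K)) := by
  rw [h.moranSet_eq_range]
  exact isCompact_range h.continuous_point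

end IsTowerData

/-! ### Random digits, the infinite convolution and its support. -/

namespace Tower

/-- The uniform probability measure on `Fin m`. -/
def uniform (m : ℕ) : Measure (Fin m) := (m : ENNReal)⁻¹ • ∑ i, Measure.dirac i

lemma uniform_singleton {m : ℕ} (i : Fin m) : uniform m {i} = (m : ENNReal)⁻¹ := by
  simp [uniform, Set.indicator_apply, Finset.sum_ite_eq']

instance (m : ℕ) [NeZero m] : IsProbabilityMeasure (uniform m) := by
  constructor
  simp [uniform, ENNReal.inv_mul_cancel, NeZero.ne m]

/-- The law of a sequence of independent uniformly distributed digits. -/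
def law (M : ℕ → ℕ) [∀ j, NeZero (M j)] : Measure (∀ j, Fin (M j)) :=
  Measure.infinitePi fun j => uniform (M j)

variable {N M K α : ℕ → ℕ}

instance [∀ j, NeZero (M j)] : IsProbabilityMeasure (law M) := by
  unfold law; infer_instance

lemma law_cylinder [∀ j, NeZero (M j)] (n : ℕ) (ω : ∀ j, Fin (M j)) :
    law M {ω' | ∀ j < n, ω' j = ω j} = (∏ j ∈ Finset.range n, (M j : ENNReal))⁻¹ := by
  have h1 : {ω' : ∀ j, Fin (M j) | ∀ j < n, ω' j = ω j} =
      Set.pi (Finset.range n : Finset ℕ) fun j => {ω j} := by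
    ext; simp
  rw [h1, law, Measure.infinitePi_pi _ fun _ _ => measurableSet_singleton _,
    ENNReal.prod_inv_distrib]
  · simp_rw [uniform_singleton]
  · intro i _ j _ _
    exact Or.inr (ENNReal.natCast_ne_top _)

lemma measurable_digitTerm (j : ℕ) : Measurable fun ω : ∀ j, Fin (M j) => digitTerm N M K j (ω j) :=
  (measurable_of_countable (digitTerm N M K j)).comp (measurable_pi_apply j)

lemma measurable_partialSum (n : ℕ) : Measurable (partialSum N M K n) :=
  Finset.measurable_fun_sum _ fun j _ => measurable_digitTerm j

end Tower

namespace IsTowerData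

open Tower

variable {N M K α : ℕ → ℕ} (h : IsTowerData N M K α)

include h

lemma measurable_point : Measurable (point N M K) :=
  measurable_of_tendsto_metrizable measurable_partialSum (tendsto_pi_nhds.2 h.tendsto_partialSum)

lemma map_uniform (j : ℕ) :
    (uniform (M j)).map (digitTerm N M K j) = levelMeasure N (towerDigits M K) j := by
  have hm : Measurable (digitTerm N M K j) := measurable_of_countable _
  rw [levelMeasure, h.card_towerDigits, uniform, Measure.map_smul, Measure.map_finset_sum hm.aemeasurable,
    towerDigits, Finset.sum_image fun a _ b _ hab => Nat.eq_of_mul_eq_mul_right (h.K_pos j) hab,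
    Finset.sum_range]
  congr 1
  exact Finset.sum_congr rfl fun i _ => Measure.map_dirac' hm i

variable [∀ j, NeZero (M j)]

/-- The next term is independent of the partial sum, so adding it convolves the laws. -/
lemma map_partialSum (n : ℕ) :
    (law M).map (partialSum N M K n) = partialConv (levelMeasure N (towerDigits M K)) n := by
  induction n with
  | zero =>
    have : partialSum N M K 0 = fun _ => 0 := by ext; simp [partialSum]
    rw [this, Measure.map_const]
    simp [partialConv]
  | succ n ih =>
    have hm (j : ℕ) : Measurable (digitTerm N M K j) := measurable_of_countable _
    have hind : ProbabilityTheory.iIndepFun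
        (fun j (ω : ∀ j, Fin (M j)) => digitTerm N M K j (ω j)) (law M) :=
      ProbabilityTheory.iIndepFun_infinitePi hm
    have e1 : partialSum N M K (n + 1) =
        (∑ j ∈ Finset.range n, fun (ω : ∀ j, Fin (M j)) => digitTerm N M K j (ω j)) +
          fun ω => digitTerm N M K n (ω n) := by
      ext ω; simp [partialSum, Finset.sum_range_succ]
    have e2 : partialSum N M K n =
        ∑ j ∈ Finset.range n, fun (ω : ∀ j, Fin (M j)) => digitTerm N M K j (ω j) := by
      ext ω; simp [partialSum]
    have hind2 := (hind.indepFun_finsetSum_of_notMem measurable_digitTerm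
      (Finset.notMem_range_self (n := n))).map_add_eq_map_conv_map
      (by rw [← e2]; exact measurable_partialSum n) (measurable_digitTerm n)
    rw [e1, hind2, ← e2, ih, partialConv, ← h.map_uniform n,
      ← Measure.infinitePi_map_eval (fun j => uniform (M j)) n,
      Measure.map_map (hm n) (measurable_pi_apply n)]
    rfl

lemma isInfiniteConv :
    IsInfiniteConv (levelMeasure N (towerDigits M K)) ((law M).map (point N M K)) := by
  refine ⟨Measure.isProbabilityMeasure_map h.measurable_point.aemeasurable, fun f => ?_⟩
  rw [integral_map h.measurable_point.aemeasurable f.continuous.aestronglyMeasurable]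
  simp_rw [← h.map_partialSum]
  have (n : ℕ) := integral_map (μ := law M) (measurable_partialSum (N := N) (K := K) n).aemeasurable
    f.continuous.aestronglyMeasurable
  simp_rw [this]
  refine tendsto_integral_of_dominated_convergence (fun _ => ‖f‖)
    (fun n => (f.continuous.measurable.comp (measurable_partialSum n)).aestronglyMeasurable)
    (integrable_const _) (fun n => Eventually.of_forall fun ω => f.norm_coe_le_norm _)
    (Eventually.of_forall fun ω => ?_)
  exact (f.continuous.tendsto _).comp (h.tendsto_partialSum ω)

lemma support_map_point :
    ((law M).map (point N M K)).support = moranSet N (towerDigits M K) := by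
  refine subset_antisymm ?_ ?_
  · refine Measure.support_subset_of_isClosed h.isCompact_moranSet.isClosed ?_
    rw [mem_ae_iff, Measure.map_apply h.measurable_point h.isCompact_moranSet.measurableSet.compl,
      h.moranSet_eq_range]
    convert! measure_empty (μ := law M)
    ext; simp
  · rw [h.moranSet_eq_range]
    rintro _ ⟨ω, rfl⟩
    rw [Metric.nhds_basis_closedBall.mem_measureSupport]
    intro ε hε
    obtain ⟨n, hn⟩ := exists_pow_lt_of_lt_one hε (by norm_num : (1 / 2 : ℝ) < 1)
    rw [Measure.map_apply h.measurable_point Metric.isClosed_closedBall.measurableSet]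
    -- The n-cylinder around ω has mass 1/Q_n > 0, and its image lies within 1/P_n ≤ 2^(-n) < ε of
    -- the given point.
    refine lt_of_lt_of_le ?_ (measure_mono (s := {ω' | ∀ j < n, ω' j = ω j}) fun ω' hω' => ?_)
    · rw [law_cylinder, ENNReal.inv_pos]
      exact ENNReal.prod_ne_top fun _ _ => ENNReal.natCast_ne_top _
    · have e : partialSum N M K n ω' = partialSum N M K n ω :=
        Finset.sum_congr rfl fun j hj => by rw [hω' j (Finset.mem_range.1 hj)]
      have h1 : (denom N n)⁻¹ ≤ (1 / 2) ^ n := by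
        have := h.two_pow_le_denom n
        rw [one_div, inv_pow]
        gcongr
      have h2 := h.partialSum_le_point n ω
      have h3 := h.partialSum_le_point n ω'
      have h4 := h.point_le n ω
      have h5 := h.point_le n ω'
      rw [Set.mem_preimage, Metric.mem_closedBall, Real.dist_eq, abs_le]
      constructor <;> linarith

end IsTowerData

/-! ### The dimension formula: upper bound by cylinder covers. -/

namespace IsTowerData

open Tower

variable {N M K α : ℕ → ℕ} (h : IsTowerData N M K α)

include h

lemma one_le_denom_M (n : ℕ) : 1 ≤ denom M n :=
  Finset.prod_induction _ (fun x : ℝ => 1 ≤ x) (fun _ _ => one_le_mul_of_one_le_of_one_le) le_rfl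
    fun j _ => by exact_mod_cast h.M_pos j

lemma denom_M_le (n : ℕ) : denom M n ≤ denom N n := by
  refine Finset.prod_le_prod (fun _ _ => Nat.cast_nonneg _) fun j _ => ?_
  have h1 := h.N_eq j
  have h2 := Nat.le_mul_of_pos_right (M j) (h.K_pos j)
  exact_mod_cast (by omega : M j ≤ N j)

lemma ediam_image_cylinder_le (n : ℕ) (w : ∀ j : Fin n, Fin (M j)) :
    Metric.ediam (point N M K '' {ω | ∀ j : Fin n, ω j = w j}) ≤
      ENNReal.ofReal (denom N n)⁻¹ := by
  refine Metric.ediam_le ?_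
  rintro _ ⟨ω, hω, rfl⟩ _ ⟨ω', hω', rfl⟩
  have e : partialSum N M K n ω = partialSum N M K n ω' :=
    Finset.sum_congr rfl fun j hj => by
      rw [hω ⟨j, Finset.mem_range.1 hj⟩, hω' ⟨j, Finset.mem_range.1 hj⟩]
  have h2 := h.partialSum_le_point n ω
  have h3 := h.partialSum_le_point n ω'
  have h4 := h.point_le n ω
  have h5 := h.point_le n ω'
  rw [edist_dist, Real.dist_eq]
  refine ENNReal.ofReal_le_ofReal (abs_le.2 ?_)
  constructor <;> linarith

/-- The d-dimensional Hausdorff measure is at most the liminf of the cover sums Q_n P_n^(-d), so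
good covers at infinitely many levels suffice. -/
lemma dimH_moranSet_le {d : NNReal}
    (hd : ∃ᶠ n in atTop, denom M n ≤ denom N n ^ (d : ℝ)) :
    dimH (moranSet N (towerDigits M K)) ≤ d := by
  refine dimH_le_of_hausdorffMeasure_ne_top (ne_top_of_le_ne_top ENNReal.one_ne_top ?_)
  have lim : Tendsto (fun n => ENNReal.ofReal (denom N n)⁻¹) atTop (𝓝 0) := by
    rw [← ENNReal.ofReal_zero]
    refine ENNReal.tendsto_ofReal (tendsto_inv_atTop_zero.comp ?_)
    exact tendsto_atTop_mono h.two_pow_le_denom (tendsto_pow_atTop_atTop_of_one_lt one_lt_two)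
  refine (Measure.hausdorffMeasure_le_liminf_sum (ι := fun n : ℕ => ∀ j : Fin n, Fin (M j)) d _ _
    lim (fun n w => point N M K '' {ω | ∀ j : Fin n, ω j = w j})
    (Eventually.of_forall fun n w => h.ediam_image_cylinder_le n w)
    (Eventually.of_forall fun n => ?_)).trans ?_
  · rw [h.moranSet_eq_range]
    rintro _ ⟨ω, rfl⟩
    exact Set.mem_iUnion.2 ⟨fun j => ω j, ω, fun _ => rfl, rfl⟩
  · refine liminf_le_of_frequently_le' (hd.mono fun n hn => ?_)
    have h0 := h.denom_pos n
    have hQ : (0 : ℝ) ≤ denom M n := zero_le_one.trans (h.one_le_denom_M n)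
    calc ∑ w : ∀ j : Fin n, Fin (M j),
          Metric.ediam (point N M K '' {ω | ∀ j : Fin n, ω j = w j}) ^ (d : ℝ)
        ≤ ∑ w : ∀ j : Fin n, Fin (M j), ENNReal.ofReal (denom N n)⁻¹ ^ (d : ℝ) :=
          Finset.sum_le_sum fun w _ =>
            ENNReal.rpow_le_rpow (h.ediam_image_cylinder_le n w) d.coe_nonneg
      _ = ENNReal.ofReal (denom M n) * ENNReal.ofReal ((denom N n)⁻¹ ^ (d : ℝ)) := by
          rw [Finset.sum_const, Finset.card_univ, Fintype.card_pi, nsmul_eq_mul,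
            ENNReal.ofReal_rpow_of_nonneg (by positivity) d.coe_nonneg,
            ← ENNReal.ofReal_natCast]
          simp only [Fintype.card_fin, denom, Finset.prod_range fun i => (M i : ℝ), Nat.cast_prod]
      _ ≤ 1 := by
          rw [← ENNReal.ofReal_mul hQ, ENNReal.ofReal_le_one, Real.inv_rpow h0.le,
            ← div_eq_mul_inv]
          exact div_le_one_of_le₀ hn (by positivity)

/-! ### Lower bound by the mass distribution principle. -/

section Lower

variable [∀ j, NeZero (M j)]

/-- The code and the next digit determine the first n + 1 digits, so the event lies in a single
cylinder or is empty. -/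
lemma law_code_le (n a i : ℕ) :
    (law M).real {ω | code N M K n ω = a ∧ (ω n : ℕ) = i} ≤ (denom M (n + 1))⁻¹ := by
  rcases Set.eq_empty_or_nonempty {ω : ∀ j, Fin (M j) | code N M K n ω = a ∧ (ω n : ℕ) = i} with
    he | ⟨ω₀, h1, h2⟩
  · rw [he, measureReal_empty]
    exact inv_nonneg.2 (zero_le_one.trans (h.one_le_denom_M _))
  · have e : (law M).real {ω | ∀ j < n + 1, ω j = ω₀ j} = (denom M (n + 1))⁻¹ := by
      rw [measureReal_def, law_cylinder, ENNReal.toReal_inv, ENNReal.toReal_prod]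
      simp [denom]
    rw [← e]
    refine measureReal_mono fun ω hω => ?_
    refine h.eq_of_code_eq (n := n + 1) ?_
    rw [code, code, hω.1, hω.2, h1, h2]

/-- Counts the cylinders of length n + 1 that can meet the interval: at most 3 codes at level n, and
for each code at most L + 1 next digits, since these lie in a window of length L after division by
the spacing K_n. -/
lemma law_point_mem_Icc_le (n : ℕ) {x ρ : ℝ} (hρ0 : 0 ≤ ρ) (hρ : ρ * denom N n ≤ 1) :
    (law M).real {ω | point N M K ω ∈ Set.Icc x (x + ρ)} ≤
      3 * ((ρ * denom N (n + 1) + 1) / K n + 1) / denom M (n + 1) := by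
  have hP := h.denom_pos n
  have hP' := h.denom_pos (n + 1)
  have hK : (0 : ℝ) < K n := by exact_mod_cast h.K_pos n
  set y := x * denom N n with hy
  set L := (ρ * denom N (n + 1) + 1) / K n with hL
  have hL0 : 0 ≤ L := by positivity
  let z (a : ℤ) : ℝ := (x * denom N (n + 1) - 1 - N n * a) / K n
  -- Since code ≤ P_n · point ≤ code + 1 and P_n · point lies in [y, y + 1], the code is within 1 of
  -- y. The same estimate at level n + 1, solved for the digit, gives the window [z a, z a + L].
  let T : Finset (Σ _ : ℤ, ℤ) :=
    (Finset.Icc (⌊y⌋ - 1) (⌊y⌋ + 1)).sigma fun a => Finset.Icc ⌈z a⌉ ⌊z a + L⌋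
  have hT : (T.card : ℝ) ≤ 3 * (L + 1) := by
    rw [Finset.card_sigma]
    push_cast
    have h3 : (Finset.Icc (⌊y⌋ - 1) (⌊y⌋ + 1)).card = 3 := by
      rw [Int.card_Icc]; omega
    refine (Finset.sum_le_card_nsmul _ _ (L + 1) fun a _ => ?_).trans (by simp [h3, mul_add])
    rw [Int.card_Icc]
    have h1 := Int.floor_le (z a + L)
    have h2 := Int.le_ceil (z a)
    rcases le_total 0 (⌊z a + L⌋ + 1 - ⌈z a⌉) with h0 | h0
    · have : (((⌊z a + L⌋ + 1 - ⌈z a⌉).toNat : ℤ) : ℝ) = ((⌊z a + L⌋ + 1 - ⌈z a⌉ : ℤ) : ℝ) := by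
        rw [Int.toNat_of_nonneg h0]
      rw [Int.cast_natCast] at this
      rw [this]
      push_cast
      linarith
    · rw [Int.toNat_of_nonpos h0]
      push_cast
      linarith
  have hsub : {ω | point N M K ω ∈ Set.Icc x (x + ρ)} ⊆
      ⋃ p ∈ T, {ω | code N M K n ω = p.1.toNat ∧ (ω n : ℕ) = p.2.toNat} := by
    rintro ω ⟨hx1, hx2⟩
    refine Set.mem_iUnion₂.2 ⟨⟨code N M K n ω, (ω n : ℕ)⟩, ?_, by simp⟩
    have l1 := h.partialSum_le_point n ω
    have l2 := h.point_le n ω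
    have l3 := h.partialSum_le_point (n + 1) ω
    have l4 := h.point_le (n + 1) ω
    rw [h.partialSum_eq_code] at l1 l2 l3 l4
    rw [div_le_iff₀ hP] at l1
    rw [div_le_iff₀ hP'] at l3
    rw [inv_eq_one_div, ← add_div, le_div_iff₀ hP] at l2
    rw [inv_eq_one_div, ← add_div, le_div_iff₀ hP'] at l4
    have a1 : y ≤ point N M K ω * denom N n := by rw [hy]; gcongr
    have a2 : point N M K ω * denom N n ≤ y + ρ * denom N n := by
      rw [hy, ← add_mul]; gcongr
    have a3 : x * denom N (n + 1) ≤ point N M K ω * denom N (n + 1) := by gcongr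
    have a4 : point N M K ω * denom N (n + 1) ≤ x * denom N (n + 1) + ρ * denom N (n + 1) := by
      rw [← add_mul]; gcongr
    have c : (code N M K (n + 1) ω : ℝ) = N n * code N M K n ω + (ω n : ℕ) * K n := by
      rw [code]; push_cast; rfl
    rw [c] at l3 l4
    have f1 := Int.floor_le y
    have f2 := Int.lt_floor_add_one y
    simp only [T, z, Finset.mem_sigma, Finset.mem_Icc, Int.ceil_le, Int.le_floor]
    refine ⟨⟨?_, ?_⟩, ?_, ?_⟩
    · have : ((⌊y⌋ - 1 : ℤ) : ℝ) ≤ ((code N M K n ω : ℤ) : ℝ) := by push_cast; linarith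
      exact_mod_cast this
    · have : ((code N M K n ω : ℤ) : ℝ) < ((⌊y⌋ + 2 : ℤ) : ℝ) := by push_cast; linarith
      have := Int.cast_lt.1 this
      omega
    · rw [div_le_iff₀ hK]
      push_cast
      linarith
    · rw [hL, ← add_div, le_div_iff₀ hK]
      push_cast
      linarith
  calc _ ≤ (law M).real
          (⋃ p ∈ T, {ω | code N M K n ω = p.1.toNat ∧ (ω n : ℕ) = p.2.toNat}) :=
        measureReal_mono hsub (measure_ne_top _ _)
    _ ≤ ∑ p ∈ T, (law M).real {ω | code N M K n ω = p.1.toNat ∧ (ω n : ℕ) = p.2.toNat} :=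
        measureReal_biUnion_finset_le _ _
    _ ≤ ∑ p ∈ T, (denom M (n + 1))⁻¹ := Finset.sum_le_sum fun p _ => h.law_code_le _ _ _
    _ = T.card * (denom M (n + 1))⁻¹ := by rw [Finset.sum_const, nsmul_eq_mul]
    _ ≤ _ := by
        rw [← div_eq_mul_inv]
        have := zero_lt_one.trans_le (h.one_le_denom_M (n + 1))
        gcongr

/-- The interval is compared with the level m for which 1/P_{m+1} ≤ ρ < 1/P_m. The constant is 15 =
3 · (4 + 1), from 3 codes and at most 4 t M_m + 1 digits with t = ρ P_m. -/
lemma law_point_mem_Icc_le_rpow {d : ℝ} (hd0 : 0 ≤ d) (hd1 : d ≤ 1) {n : ℕ}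
    (hn : ∀ m ≥ n, denom N m ^ d ≤ denom M m) {ρ : ℝ} (hρ0 : 0 < ρ) (hρ : ρ < (denom N n)⁻¹)
    (x : ℝ) :
    (law M).real {ω | point N M K ω ∈ Set.Icc x (x + ρ)} ≤ 15 * ρ ^ d := by
  have hex : ∃ k, (denom N (n + k))⁻¹ ≤ ρ := by
    obtain ⟨k, hk⟩ := exists_pow_lt_of_lt_one hρ0 (by norm_num : (1 / 2 : ℝ) < 1)
    refine ⟨k, le_trans ?_ hk.le⟩
    rw [one_div, inv_pow]
    have := (pow_le_pow_right₀ one_le_two (Nat.le_add_left k n)).trans (h.two_pow_le_denom (n + k))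
    gcongr
  obtain ⟨m, hnm, hm1, hm2⟩ : ∃ m ≥ n, ρ < (denom N m)⁻¹ ∧ (denom N (m + 1))⁻¹ ≤ ρ := by
    have h0 : Nat.find hex ≠ 0 := fun h0 => by
      have := Nat.find_spec hex
      rw [h0, add_zero] at this
      exact absurd hρ this.not_gt
    obtain ⟨k, hk⟩ := Nat.exists_eq_succ_of_ne_zero h0
    refine ⟨n + k, Nat.le_add_right _ _, ?_, ?_⟩
    · exact not_le.1 (Nat.find_min hex (hk ▸ Nat.lt_succ_self k))
    · have := Nat.find_spec hex
      rwa [hk] at this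
  have hP := h.denom_pos m
  have hP' := h.denom_pos (m + 1)
  have hQ := zero_lt_one.trans_le (h.one_le_denom_M m)
  have hQ' := zero_lt_one.trans_le (h.one_le_denom_M (m + 1))
  have hK : (0 : ℝ) < K m := by exact_mod_cast h.K_pos m
  have hM : (0 : ℝ) < M m := by exact_mod_cast h.M_pos m
  have ht1 : ρ * denom N m < 1 := by rwa [← lt_inv_mul_iff₀' hP, mul_one]
  have ht2 : 1 ≤ ρ * denom N (m + 1) := by rwa [← inv_le_iff_one_le_mul₀ hP']
  refine (h.law_point_mem_Icc_le m hρ0.le ht1.le).trans ?_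
  -- α_m < M_m ≤ M_m K_m: the remainder at most doubles the base.
  have hN : (N m : ℝ) ≤ 2 * (M m * K m) := by
    have h1 := h.N_eq m
    have h2 := h.α_lt m
    have h3 := Nat.le_mul_of_pos_right (M m) (h.K_pos m)
    exact_mod_cast (by omega : N m ≤ 2 * (M m * K m))
  set t := ρ * denom N m with ht
  have ht0 : 0 < t := by positivity
  have hcount : (ρ * denom N (m + 1) + 1) / K m ≤ 4 * (t * M m) := by
    rw [div_le_iff₀ hK]
    have : ρ * denom N (m + 1) = t * N m := by rw [denom_succ, ht]; ring
    have : t * N m ≤ t * (2 * (M m * K m)) := by gcongr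
    linarith
  -- If t M_m ≤ 1, boundedly many cylinders meet the interval, and the hypothesis at level m + 1
  -- with 1/P_{m+1} ≤ ρ suffices. Otherwise the mass is at most 15 t / Q_m, and t ≤ t^d (from t < 1,
  -- d ≤ 1) reduces to level m.
  rcases le_total (t * M m) 1 with hc | hc
  · have h1 : (denom M (m + 1))⁻¹ ≤ ρ ^ d := calc
      (denom M (m + 1))⁻¹ ≤ (denom N (m + 1) ^ d)⁻¹ := by
        have := hn (m + 1) (by omega)
        gcongr
      _ = (denom N (m + 1))⁻¹ ^ d := (Real.inv_rpow hP'.le d).symm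
      _ ≤ ρ ^ d := by gcongr
    calc _ ≤ 15 * (denom M (m + 1))⁻¹ := by
          rw [div_eq_mul_inv]
          gcongr
          linarith
      _ ≤ _ := by gcongr
  · have h1 : t / denom M m ≤ ρ ^ d := calc
      t / denom M m ≤ t ^ d / denom N m ^ d := by
        have := hn m hnm
        have : t ≤ t ^ d := Real.self_le_rpow_of_le_one ht0.le ht1.le hd1
        gcongr
      _ = ρ ^ d := by
        rw [ht, Real.mul_rpow hρ0.le hP.le, mul_div_assoc, div_self (by positivity), mul_one]
    calc _ ≤ 15 * (t * M m) / denom M (m + 1) :=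
          div_le_div_of_nonneg_right (by linarith) hQ'.le
      _ = 15 * (t / denom M m) := by
          rw [denom_succ]; field_simp
      _ ≤ _ := by gcongr

lemma le_dimH_moranSet_of_le_one {d : NNReal} (hd1 : d ≤ 1)
    (hd : ∀ᶠ n in atTop, denom N n ^ (d : ℝ) ≤ denom M n) :
    d ≤ dimH (moranSet N (towerDigits M K)) := by
  obtain ⟨n, hn⟩ := eventually_atTop.1 hd
  have hP := h.denom_pos n
  have hm := h.measurable_point
  -- The factor 2^d arises because a set of diameter r is enclosed in an interval of length 2ρ with
  -- ρ > r. Diameters up to 1/(4 P_n) leave room to take 2ρ < 1/P_n.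
  set c : ENNReal := ENNReal.ofReal (15 * 2 ^ (d : ℝ)) with hc
  have hc0 : c ≠ 0 := by rw [hc, Ne, ENNReal.ofReal_eq_zero, not_le]; positivity
  have key : c⁻¹ • (law M).map (point N M K) ≤ Measure.hausdorffMeasure d := by
    refine Measure.le_hausdorffMeasure d _ (ENNReal.ofReal ((denom N n)⁻¹ / 4))
      (ENNReal.ofReal_pos.2 (by positivity)) fun s hs => ?_
    rcases s.eq_empty_or_nonempty with rfl | ⟨x, hx⟩
    · simp
    rw [Measure.smul_apply, smul_eq_mul, ENNReal.inv_mul_le_iff hc0 ENNReal.ofReal_ne_top]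
    have hfin : Metric.ediam s ≠ ⊤ := ne_top_of_le_ne_top ENNReal.ofReal_ne_top hs
    obtain ⟨r, hr0, hr⟩ : ∃ r : ℝ, 0 ≤ r ∧ Metric.ediam s = ENNReal.ofReal r :=
      ⟨_, ENNReal.toReal_nonneg, (ENNReal.ofReal_toReal hfin).symm⟩
    rw [hr, ENNReal.ofReal_le_ofReal_iff (by positivity)] at hs
    rw [hr, ENNReal.ofReal_rpow_of_nonneg hr0 d.coe_nonneg, hc, ← ENNReal.ofReal_mul (by positivity),
      mul_assoc, ← Real.mul_rpow zero_le_two hr0]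
    -- The interval estimate needs positive length while r may be 0, so the bound is obtained for ρ
    -- > r and passed to the limit.
    have lim : Tendsto (fun ρ : ℝ => ENNReal.ofReal (15 * (2 * ρ) ^ (d : ℝ))) (𝓝[>] r)
        (𝓝 (ENNReal.ofReal (15 * (2 * r) ^ (d : ℝ)))) := by
      have : Continuous fun ρ : ℝ => ENNReal.ofReal (15 * (2 * ρ) ^ (d : ℝ)) :=
        ENNReal.continuous_ofReal.comp (continuous_const.mul
          ((continuous_const.mul continuous_id).rpow_const fun _ => Or.inr d.coe_nonneg))
      exact this.continuousWithinAt
    refine ge_of_tendsto lim ?_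
    have hrP : r < (denom N n)⁻¹ / 2 := by
      have := inv_pos.2 hP
      linarith
    filter_upwards [Ioo_mem_nhdsGT hrP] with ρ hρ
    have hsub : s ⊆ Set.Icc (x - ρ) (x - ρ + 2 * ρ) := fun y hy => by
      have h1 := Metric.edist_le_ediam_of_mem hy hx
      rw [hr, edist_dist, ENNReal.ofReal_le_ofReal_iff hr0, Real.dist_eq, abs_le] at h1
      constructor <;> linarith [hρ.1]
    have h1 := h.law_point_mem_Icc_le_rpow d.coe_nonneg (by exact_mod_cast hd1) hn
      (by linarith [hρ.1] : 0 < 2 * ρ) (by linarith [hρ.2]) (x - ρ)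
    refine (measure_mono hsub).trans ?_
    rw [Measure.map_apply hm measurableSet_Icc]
    exact (ENNReal.le_ofReal_iff_toReal_le (measure_ne_top _ _)
      (measureReal_nonneg.trans h1)).2 h1
  refine le_dimH_of_hausdorffMeasure_ne_zero fun h0 => ?_
  -- A null Hausdorff measure would contradict that the set carries total mass 1.
  have h1 := key (moranSet N (towerDigits M K))
  rw [h0, Measure.smul_apply, Measure.map_apply hm h.isCompact_moranSet.measurableSet,
    h.moranSet_eq_range, Set.preimage_range, measure_univ, smul_eq_mul, mul_one] at h1
  exact ENNReal.ofReal_ne_top (ENNReal.inv_eq_zero.1 (le_zero_iff.1 h1))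

end Lower

/-- The restriction d ≤ 1 is automatic: P_n^d ≤ Q_n ≤ P_n with P_n > 1. -/
lemma le_dimH_moranSet {d : NNReal} (hd : ∀ᶠ n in atTop, denom N n ^ (d : ℝ) ≤ denom M n) :
    d ≤ dimH (moranSet N (towerDigits M K)) := by
  have (j : ℕ) : NeZero (M j) := ⟨(h.M_pos j).ne'⟩
  refine h.le_dimH_moranSet_of_le_one ?_ hd
  obtain ⟨n, hn, hn1⟩ := (hd.and (eventually_ge_atTop 1)).exists
  have h1 : (1 : ℝ) < denom N n :=
    (one_lt_pow₀ one_lt_two (by omega)).trans_le (h.two_pow_le_denom n)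
  have h2 : denom N n ^ (d : ℝ) ≤ denom N n ^ (1 : ℝ) := by
    rw [Real.rpow_one]; exact hn.trans (h.denom_M_le n)
  exact_mod_cast (Real.rpow_le_rpow_left_iff h1).1 h2

lemma log_denom_pos (j : ℕ) : 0 < Real.log (denom N (j + 1)) :=
  Real.log_pos ((one_lt_pow₀ one_lt_two (by omega)).trans_le (h.two_pow_le_denom (j + 1)))

/-- A d above the liminf gives Q_n < P_n^d infinitely often, a d below it gives P_n^d < Q_n
eventually: exactly the hypotheses of the two bounds. Levels start at j + 1 because log P_0 = 0. -/
theorem dimH_moranSet_eq_liminf :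
    dimH (moranSet N (towerDigits M K)) = liminf (fun j : ℕ => ENNReal.ofReal
      (Real.log (denom M (j + 1)) / Real.log (denom N (j + 1)))) atTop := by
  have hQ (j : ℕ) := zero_lt_one.trans_le (h.one_le_denom_M (j + 1))
  refine le_antisymm ?_ ?_
  · refine le_of_forall_gt fun e he => ?_
    obtain ⟨d, hd1, hd2⟩ := ENNReal.lt_iff_exists_nnreal_btwn.1 he
    refine lt_of_le_of_lt (h.dimH_moranSet_le ?_) hd2
    refine (tendsto_add_atTop_nat 1).frequently
      ((frequently_lt_of_liminf_lt (by isBoundedDefault) hd1).mono fun j hj => ?_)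
    rw [← ENNReal.ofReal_coe_nnreal] at hj
    have h1 := (ENNReal.ofReal_lt_ofReal_iff'.1 hj).1
    rw [div_lt_iff₀ (h.log_denom_pos j), ← Real.log_rpow (h.denom_pos _)] at h1
    exact ((Real.log_lt_log_iff (hQ j) (Real.rpow_pos_of_pos (h.denom_pos _) _)).1 h1).le
  · refine le_of_forall_lt fun e he => ?_
    obtain ⟨d, hd1, hd2⟩ := ENNReal.lt_iff_exists_nnreal_btwn.1 he
    refine lt_of_lt_of_le hd1 (h.le_dimH_moranSet ?_)
    rw [← map_add_atTop_eq_nat 1]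
    refine eventually_map.2 ((eventually_lt_of_lt_liminf hd2).mono fun j hj => ?_)
    rw [← ENNReal.ofReal_coe_nnreal] at hj
    have h1 := (ENNReal.ofReal_lt_ofReal_iff'.1 hj).1
    rw [lt_div_iff₀ (h.log_denom_pos j), ← Real.log_rpow (h.denom_pos _)] at h1
    exact ((Real.log_lt_log_iff (Real.rpow_pos_of_pos (h.denom_pos _) _) (hQ j)).1 h1).le

end IsTowerData

/-! ### Examples of dimension zero and of positive dimension. -/

namespace IsTowerData

open Tower

variable {N M K α : ℕ → ℕ}

lemma dimH_moranSet_eq_of_tendsto (h : IsTowerData N M K α) {x : ℝ}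
    (hx : Tendsto (fun j : ℕ => Real.log (denom M (j + 1)) / Real.log (denom N (j + 1)))
      atTop (𝓝 x)) :
    dimH (moranSet N (towerDigits M K)) = ENNReal.ofReal x := by
  rw [h.dimH_moranSet_eq_liminf]
  exact (ENNReal.tendsto_ofReal hx).liminf_eq

/-- Towers with two digits and at least geometrically growing bases. -/
lemma of_three_pow_le (hN : ∀ j, N j = 2 * K j + 1) (h3 : ∀ j, 3 ^ (j + 1) ≤ N j) :
    IsTowerData N (fun _ => 2) K (fun _ => 1) := by
  have hK (j : ℕ) : 3 ^ j ≤ K j := by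
    have h1 := h3 j
    have h2 := hN j
    have h4 := Nat.one_le_pow j 3 (by norm_num)
    rw [pow_succ] at h1
    omega
  have hpos (j : ℕ) : 0 < K j := lt_of_lt_of_le (by positivity) (hK j)
  refine ⟨fun j => ?_, fun _ => two_pos, hpos, hN, fun _ => one_lt_two, ?_⟩
  · have := hN j
    have := hpos j
    omega
  · refine Summable.of_nonneg_of_le (fun j => by positivity) (fun j => ?_)
      ((summable_geometric_of_lt_one (r := 1 / 3) (by norm_num) (by norm_num)).mul_left √2)
    have : (3 : ℝ) ^ j ≤ K j := by exact_mod_cast hK j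
    simp only [Nat.cast_one, one_mul, Nat.cast_ofNat]
    rw [one_div, inv_pow, div_eq_mul_inv]
    gcongr

lemma dimH_eq_zero_of_three_pow_le (hN : ∀ j, N j = 2 * K j + 1) (h3 : ∀ j, 3 ^ (j + 1) ≤ N j) :
    dimH (moranSet N (towerDigits (fun _ => 2) K)) = 0 := by
  have h := of_three_pow_le hN h3
  rw [h.dimH_moranSet_eq_of_tendsto (x := 0), ENNReal.ofReal_zero]
  -- Since log N_j ≥ (j + 1) log 3 ≥ j + 1, the sum is at least n(n + 1)/2; against log Q_n = n log
  -- 2 the ratio is O(1/n).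
  have hlog (n : ℕ) : (n * n / 2 : ℝ) ≤ Real.log (denom N n) := by
    induction n with
    | zero => simp
    | succ n ih =>
      have hNpos : (0 : ℝ) < N n := by exact_mod_cast zero_lt_two.trans_le (h.two_le_N n)
      have h1 : (1 : ℝ) ≤ Real.log 3 := by
        rw [Real.le_log_iff_exp_le (by norm_num)]
        linarith [Real.exp_one_lt_d9]
      have h2 : ((n : ℝ) + 1) * Real.log 3 ≤ Real.log (N n) := by
        have : Real.log ((3 : ℝ) ^ (n + 1)) ≤ Real.log (N n) :=
          Real.log_le_log (by positivity) (by exact_mod_cast h3 n)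
        rw [Real.log_pow] at this
        exact_mod_cast this
      rw [denom_succ, Real.log_mul (h.denom_pos n).ne' hNpos.ne']
      push_cast
      have : ((n : ℝ) + 1) * 1 ≤ ((n : ℝ) + 1) * Real.log 3 := by gcongr
      nlinarith
  refine squeeze_zero (g := fun j : ℕ => 2 * Real.log 2 * (1 / ((j : ℝ) + 1))) (fun j => ?_)
    (fun j => ?_) ?_
  · exact div_nonneg (Real.log_nonneg (h.one_le_denom_M _)) (h.log_denom_pos j).le
  · have h1 : denom (fun _ => 2) (j + 1) = 2 ^ (j + 1) := by simp [denom]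
    have h2 := hlog (j + 1)
    have hl := Real.log_pos one_lt_two
    rw [h1, Real.log_pow, div_le_iff₀ (h.log_denom_pos j)]
    push_cast at h2 ⊢
    calc ((j : ℝ) + 1) * Real.log 2
        = 2 * Real.log 2 * (1 / ((j : ℝ) + 1)) * (((j : ℝ) + 1) * ((j : ℝ) + 1) / 2) := by
          field_simp
      _ ≤ _ := by gcongr
  · simpa using tendsto_one_div_add_atTop_nhds_zero_nat.const_mul (2 * Real.log 2)

section Rpow

variable {β a : ℝ}

/-- Here √M_j / K_j = K_j^(-(1 - β/2)) ≤ (j + 1)^(-a(1 - β/2)), a convergent p-series. -/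
lemma of_rpow (hβ : 0 < β) (ha : 1 < a * (1 - β / 2)) (hβ2 : β < 2) (hK2 : ∀ j, 2 ≤ K j)
    (hK : ∀ j : ℕ, ((j : ℝ) + 1) ^ a ≤ K j) (hM : ∀ j, (M j : ℝ) = (K j : ℝ) ^ β) :
    IsTowerData (fun j => M j * K j + 1) M K (fun _ => 1) := by
  have hK1 (j : ℕ) : (1 : ℝ) < K j := by exact_mod_cast hK2 j
  have hM1 (j : ℕ) : 1 < M j := by
    have := Real.one_lt_rpow (hK1 j) hβ
    rw [← hM] at this
    exact_mod_cast this
  refine ⟨fun j => ?_, fun j => zero_lt_one.trans (hM1 j), fun j => zero_lt_two.trans_le (hK2 j),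
    fun _ => rfl, hM1, ?_⟩
  · have := Nat.mul_pos (zero_lt_one.trans (hM1 j)) (zero_lt_two.trans_le (hK2 j))
    show 2 ≤ M j * K j + 1
    omega
  · have hs : Summable fun j : ℕ => 1 / ((j + 1 : ℕ) : ℝ) ^ (a * (1 - β / 2)) :=
      (summable_nat_add_iff 1).2 (Real.summable_one_div_nat_rpow.2 ha)
    refine Summable.of_nonneg_of_le (fun j => by positivity) (fun j => ?_) hs
    have h0 : (0 : ℝ) < K j := zero_lt_one.trans (hK1 j)
    have e : (1 : ℕ) * √(M j : ℝ) / (K j : ℝ) = 1 / (K j : ℝ) ^ (1 - β / 2) := by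
      rw [hM, Real.sqrt_eq_rpow, ← Real.rpow_mul h0.le, Real.rpow_sub h0, Real.rpow_one,
        Nat.cast_one, one_mul, mul_one_div, one_div_div]
    rw [e, Real.rpow_mul (by positivity)]
    have := hK j
    have h2 : 0 ≤ 1 - β / 2 := by linarith
    push_cast
    gcongr

/-- With L_n = log(K_0 ⋯ K_{n-1}), log Q_n = β L_n and log P_n lies between (1 + β) L_n and (1 + β)
L_n + S. The error S from the added 1 in N_j is bounded by the tower's convergent series, while L_n
tends to infinity. -/
lemma dimH_of_rpow (hβ : 0 < β) (hK2 : ∀ j, 2 ≤ K j) (hM : ∀ j, (M j : ℝ) = (K j : ℝ) ^ β)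
    (h : IsTowerData (fun j => M j * K j + 1) M K (fun _ => 1)) :
    dimH (moranSet (fun j => M j * K j + 1) (towerDigits M K)) =
      ENNReal.ofReal (β / (1 + β)) := by
  refine h.dimH_moranSet_eq_of_tendsto ?_
  set N : ℕ → ℕ := fun j => M j * K j + 1
  have hK0 (j : ℕ) : (0 : ℝ) < K j := by exact_mod_cast h.K_pos j
  have hM0 (j : ℕ) : (0 : ℝ) < M j := by exact_mod_cast h.M_pos j
  let S := ∑' j, ((1 : ℕ) : ℝ) * √(M j : ℝ) / (K j : ℝ)
  let L (n : ℕ) : ℝ := Real.log (denom K n)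
  have hKpos (n : ℕ) : 0 < denom K n := Finset.prod_pos fun j _ => hK0 j
  have hL (n : ℕ) : n * Real.log 2 ≤ L n := by
    rw [← Real.log_pow]
    refine Real.log_le_log (by positivity) ?_
    have := Finset.prod_le_prod (s := Finset.range n) (f := fun _ => (2 : ℝ))
      (g := fun j => (K j : ℝ)) (fun _ _ => zero_le_two) fun j _ => by exact_mod_cast hK2 j
    simpa [denom] using this
  have hMlog (n : ℕ) : Real.log (denom M n) = β * L n := by
    rw [← Real.log_rpow (hKpos n), denom, denom, ← Real.finsetProd_rpow _ _ fun j _ => (hK0 j).le]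
    simp_rw [hM]
  have hNlog (n : ℕ) : Real.log (denom N n) = ∑ j ∈ Finset.range n, Real.log (N j) :=
    Real.log_prod fun j _ => by simp only [N]; push_cast; have := hM0 j; have := hK0 j; positivity
  have hMKlog (n : ℕ) : ∑ j ∈ Finset.range n, Real.log (M j * K j) = (1 + β) * L n := by
    rw [Finset.sum_congr rfl fun j _ => Real.log_mul (hM0 j).ne' (hK0 j).ne',
      Finset.sum_add_distrib, ← Real.log_prod fun j _ => (hM0 j).ne',
      ← Real.log_prod fun j _ => (hK0 j).ne']
    have := hMlog n
    simp only [denom, L] at this ⊢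
    rw [this]; ring
  have hlow (n : ℕ) : (1 + β) * L n ≤ Real.log (denom N n) := by
    rw [hNlog, ← hMKlog]
    refine Finset.sum_le_sum fun j _ => Real.log_le_log (mul_pos (hM0 j) (hK0 j)) ?_
    simp [N]
  have hupp (n : ℕ) : Real.log (denom N n) ≤ (1 + β) * L n + S := by
    have h1 : ∑ j ∈ Finset.range n, ((1 : ℕ) : ℝ) * √(M j : ℝ) / (K j : ℝ) ≤ S :=
      h.summable.sum_le_tsum _ fun j _ => by positivity
    refine le_trans ?_ (add_le_add_right h1 _)
    rw [hNlog, ← hMKlog, ← Finset.sum_add_distrib]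
    refine Finset.sum_le_sum fun j _ => ?_
    have hMK := mul_pos (hM0 j) (hK0 j)
    have e : (N j : ℝ) = M j * K j * (1 + 1 / (M j * K j)) := by
      simp only [N]; push_cast; have := (hM0 j).ne'; have := (hK0 j).ne'; field_simp
    have h2 : Real.log (1 + 1 / (M j * K j)) ≤ 1 / (M j * K j) := by
      have := Real.log_le_sub_one_of_pos (x := 1 + 1 / ((M j : ℝ) * K j)) (by positivity)
      linarith
    have hM1 : (1 : ℝ) ≤ M j := by exact_mod_cast h.M_pos j
    have h3 : 1 / ((M j : ℝ) * K j) ≤ (1 : ℕ) * √(M j : ℝ) / (K j : ℝ) := by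
      have h4 : 1 ≤ √(M j : ℝ) := Real.one_le_sqrt.2 hM1
      rw [Nat.cast_one, one_mul]
      exact div_le_div₀ (by positivity) h4 (hK0 j) (le_mul_of_one_le_left (hK0 j).le hM1)
    rw [e, Real.log_mul hMK.ne' (by positivity)]
    linarith
  have hl := Real.log_pos one_lt_two
  have hLpos (j : ℕ) : 0 < L (j + 1) :=
    lt_of_lt_of_le (by positivity) (hL (j + 1))
  have hLtop : Tendsto (fun j => L (j + 1)) atTop atTop :=
    (tendsto_atTop_mono hL (tendsto_natCast_atTop_atTop.atTop_mul_const hl)).comp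
      (tendsto_add_atTop_nat 1)
  have hlim : Tendsto (fun j => β / ((1 + β) + S / L (j + 1))) atTop (𝓝 (β / (1 + β))) := by
    have : Tendsto (fun j => (1 + β) + S / L (j + 1)) atTop (𝓝 (1 + β + 0)) :=
      (hLtop.const_div_atTop S).const_add _
    rw [add_zero] at this
    exact tendsto_const_nhds.div this (by positivity)
  refine tendsto_of_tendsto_of_tendsto_of_le_of_le hlim tendsto_const_nhds (fun j => ?_) fun j => ?_
  · have h1 := hLpos j
    have h2 := h.log_denom_pos j
    have h3 := hupp (j + 1)
    have e : β / ((1 + β) + S / L (j + 1)) = β * L (j + 1) / ((1 + β) * L (j + 1) + S) := by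
      field_simp
    simp only
    rw [e, hMlog]
    gcongr
  · have h1 := hLpos j
    have h2 := hlow (j + 1)
    have e : β / (1 + β) = β * L (j + 1) / ((1 + β) * L (j + 1)) := by
      field_simp
    simp only
    rw [e, hMlog]
    gcongr

end Rpow

end IsTowerData

/-- Any admissible C exceeds 1, so the two-sided bounds with C follow from the exact value β/(1 +
β). -/
lemma one_lt_of_eventually_log_le {C : ℝ}
    (hC : ∀ᶠ x : ℝ in atTop, Real.log (1 + x) ≤ C * Real.log x) : 1 < C := by
  obtain ⟨x, hx, hx1⟩ := (hC.and (eventually_gt_atTop 1)).exists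
  have h1 := Real.log_pos hx1
  have h2 := Real.log_lt_log (zero_lt_one.trans hx1) (by linarith : x < 1 + x)
  by_contra hc
  nlinarith [not_lt.1 hc]

end

theorem mainTheorem5 :
    -- the dimension formula, for the support of the measure of every tower
    (∀ N M K α : ℕ → ℕ, IsTowerData N M K α →
      ∃ μ : Measure ℝ,
        IsInfiniteConv (levelMeasure N (towerDigits M K)) μ ∧
        μ.support = moranSet N (towerDigits M K) ∧
        dimH (moranSet N (towerDigits M K)) =
          liminf (fun j : ℕ => ENNReal.ofReal
            (Real.log (∏ i ∈ Finset.range (j + 1), (M i : ℝ)) /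
              Real.log (∏ i ∈ Finset.range (j + 1), (N i : ℝ)))) atTop) ∧
    -- the towers `N_j = p ^ j = 2 K_j + 1`, `M_j = 2`, `p` an odd prime, have dimension `0`
    (∀ (p : ℕ) (K : ℕ → ℕ), p.Prime → p ≠ 2 → (∀ j, p ^ (j + 1) = 2 * K j + 1) →
      IsTowerData (fun j => p ^ (j + 1)) (fun _ => 2) K (fun _ => 1) ∧
      dimH (moranSet (fun j => p ^ (j + 1)) (towerDigits (fun _ => 2) K)) = 0) ∧
    -- the non-spectral example: `N_j = p ^ (2 j - 1) = 2 K_j + 1`, `M_j = 2`, `p ≡ 3 mod 4` prime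
    (∀ (p : ℕ) (K : ℕ → ℕ), p.Prime → p % 4 = 3 → (∀ j, p ^ (2 * j + 1) = 2 * K j + 1) →
      IsTowerData (fun j => p ^ (2 * j + 1)) (fun _ => 2) K (fun _ => 1) ∧
      dimH (moranSet (fun j => p ^ (2 * j + 1)) (towerDigits (fun _ => 2) K)) = 0) ∧
    -- the towers `M_j = K_j ^ β`, `N_j = M_j K_j + 1` have positive dimension
    (∀ (β a : ℝ) (M K : ℕ → ℕ), 0 < β → β < 2 → 1 ≤ a → 1 < a * (1 - β / 2) →
      (∀ j, 2 ≤ K j) → (∀ j : ℕ, ((j : ℝ) + 1) ^ a ≤ (K j : ℝ)) →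
      (∀ j, (M j : ℝ) = (K j : ℝ) ^ β) →
      IsTowerData (fun j => M j * K j + 1) M K (fun _ => 1) ∧
      0 < dimH (moranSet (fun j => M j * K j + 1) (towerDigits M K)) ∧
      ∀ C : ℝ, 0 < C →
        (∀ᶠ x : ℝ in atTop, C⁻¹ * Real.log x ≤ Real.log (1 + x) ∧
          Real.log (1 + x) ≤ C * Real.log x) →
        ENNReal.ofReal (β / (C * (1 + β))) ≤
            dimH (moranSet (fun j => M j * K j + 1) (towerDigits M K)) ∧
          dimH (moranSet (fun j => M j * K j + 1) (towerDigits M K)) ≤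
            ENNReal.ofReal (C * β / (1 + β))) := by
  refine ⟨fun N M K α h => ?_, fun p K hp hp2 hK => ?_, fun p K hp hp4 hK => ?_,
    fun β a M K hβ hβ2 _ ha hK2 hK hM => ?_⟩
  · have (j : ℕ) : NeZero (M j) := ⟨(h.M_pos j).ne'⟩
    exact ⟨_, h.isInfiniteConv, h.support_map_point, h.dimH_moranSet_eq_liminf⟩
  · have h3 : 3 ≤ p := by have := hp.two_le; omega
    have h3' (j : ℕ) : 3 ^ (j + 1) ≤ p ^ (j + 1) := Nat.pow_le_pow_left h3 _
    exact ⟨.of_three_pow_le hK h3', IsTowerData.dimH_eq_zero_of_three_pow_le hK h3'⟩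
  · have h3 : 3 ≤ p := by omega
    have h3' (j : ℕ) : 3 ^ (j + 1) ≤ p ^ (2 * j + 1) :=
      (Nat.pow_le_pow_left h3 _).trans (Nat.pow_le_pow_right (by omega) (by omega))
    exact ⟨.of_three_pow_le hK h3', IsTowerData.dimH_eq_zero_of_three_pow_le hK h3'⟩
  · have h := IsTowerData.of_rpow hβ ha hβ2 hK2 hK hM
    rw [IsTowerData.dimH_of_rpow hβ hK2 hM h]
    refine ⟨h, ENNReal.ofReal_pos.2 (by positivity), fun C hC0 hC => ?_⟩
    have hC1 := one_lt_of_eventually_log_le (hC.mono fun _ hx => hx.2)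
    constructor
    · refine ENNReal.ofReal_le_ofReal ?_
      gcongr
      nlinarith
    · refine ENNReal.ofReal_le_ofReal ?_
      gcongr
      nlinarith
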